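/- **Proposition 3 (hybrid scheme).** *Model.* A matrix $\mathbf W\in\mathbb F_{2^L}^{m\times r}$, $m\ge 1$, is used by $K\ge 1$ edge nodes (ENs) to serve $N$ users; user $n$ has $\boldsymbol x_n\in\mathbb F_{2^L}^{r}$ and wants $\mathbf W\boldsymbol x_n$; $\mathbf X=[\boldsymbol x_1,\dots,\boldsymbol x_N]$. Each EN can store $m\mu$ coded rows, where $\mu\in[1/K,1]$ and $m\mu$ is an integer, and $N\ge\lfloor K\mu\rfloor$. EN $k$ needs time $\lambda_k+\tau j$ for its first $j\geq 1$ computations, where the $\lambda_k$ are independent exponential variables of mean $1/\eta$, and $\eta,\tau>0$. The $N\times K$ complex channel matrix in each downlink block is random with an absolutely continuous law, known to the ENs; the noise has unit power and each EN has transmit power at most $P$. *Scheme.* Given $(q,\rho_1,\rho_2)$, let $b=\rho_1 m/\binom{K}{\rho_2}$. The rows of $\mathbf W$ are encoded by a generator matrix of a $(\rho_1m,m)$ MDS code into rows $\boldsymbol c_1,\dots,\boldsymbol c_{\rho_1 m}$, and each set of $\rho_2$ ENs is assigned $b$ of these, which are stored at each EN of the set. Each EN runs a schedule of $m\mu$ computations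 $\boldsymbol c_i\mathbf X$, selected from its stored rows and covering all of them. The computing phase ends at the first time $T_C$ at which $q$ ENs have completed their schedules. Of the values $\boldsymbol c_i\mathbf X$ computed at these ENs, $m$ values of the largest redundancies are then sent, where the redundancy of a value is the number of these ENs that computed it. A value of redundancy $r_i$ ($\leq N$) is sent by those $r_i$ ENs jointly with zero-forcing (ZF) precoding, serving $r_i$ users at a time, cyclically over the users. If $T_D$ is the total downlink time at power $P$, let $\delta_C=T_C/\tau$ and $\delta_D=\lim_{P\to\infty}T_D/(NL/\log P)$; the average total latency is $\delta=\mathrm E[\delta_C]+\gamma\,\mathrm E[\delta_D]$, $\gamma\ge0$. *Admissible parameters.* $(q,\rho_1,\rho_2)$ is admissible if $q\in\{\lceil 1/\mu\rceil,\dots,K\}$, $\rho_1\in\{1,\tfrac{q+1}{q},\dots,\tfrac Kq\}$, $\rho_2\in\{\lfloor q\mu\rfloor,\dots,\lfloor K\mu\rfloor\}$, $b$ is an integer, and $$\text{(condition1)}\ \ \rho_1\rho_2\le K\mu,\qquad \text{(condition2)}\ \ \binom{K}{\rho_2}-\binom{K-q}{\rho_2}\ \ge\ \frac1{\rho_1}\binom{K}{\rho_2}.$$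 Assume that there are admissible parameters and that the $(\rho_1m,m)$ MDS codes over $\mathbb F_{2^L}$ exist for all admissible parameters. *Claim.* For admissible parameters every vector of numbers of completed computations at which the computing phase may stop is feasible (the computed values determine $\mathbf W\mathbf X$), the $m$ values sent determine $\mathbf W\mathbf X$, the limit $\delta_D$ exists almost surely, $\delta_C,\delta_D$ are integrable, and $$\delta=\frac{H_K-H_{K-q}}{\eta\tau}+m\mu+\gamma D(q,\rho_1,\rho_2),\qquad D(q,\rho_1,\rho_2)=\sum_{r_i=r_q}^{r_{\max}}\frac{B_i}{r_i}+\frac{m-\sum_{r_i=r_q}^{r_{\max}}B_i}{r_q-1},$$ where $H_k=\sum_{j=1}^k 1/j$, $r_{\min}=\max\{\rho_2-(K-q),1\}$, $r_{\max}=\min\{q,\rho_2\}$, $B_i=\binom{q}{r_i}\binom{K-q}{\rho_2-r_i}b$, $r_q=\min\{r\ge r_{\min}:\sum_{r_i=r}^{r_{\max}}B_i\le m\}$, and the last fraction is read as $0$ when its numerator is $0$ (in particular when $r_q=1$). Consequently the least average total latency of a hybrid scheme with admissible parameters exists and equals $$\delta_{HS}=\min_{q}\Big[\frac{H_K-H_{K-q}}{\eta\tau}+m\mu+\gamma\min_{(\rho_1,\rho_2)}D(q,\rho_1,\rho_2)\Big],$$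 the minima being over the $q$ for which there is an admissible $(q,\rho_1,\rho_2)$ and, for such $q$, over these $(\rho_1,\rho_2)$. -/

import Mathlib

open MeasureTheory ProbabilityTheory Filter Topology

noncomputable section

/-- `G` generates an `(n, m)` maximum distance separable code: the minimum Hamming distance
of the code `{G v}` is at least (hence, by the Singleton bound, equal to) `n - m + 1`. -/
def IsMDS {F : Type*} [Field F] [DecidableEq F] {n m : ℕ} (G : Matrix (Fin n) (Fin m) F) : Prop :=
  ∀ v : Fin m → F, v ≠ 0 → n + 1 ≤ hammingNorm (G.mulVec v) + m

/-- The admissible design parameters `(q, ρ₁, ρ₂)` for `K` edge nodes, `m` model rows and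
fractional storage capacity `μ`.  The last clause says that `b = ρ₁ m / (K choose ρ₂)`, the
number of coded rows assigned to each set of `ρ₂` edge nodes, is an integer. -/
def Admissible (K m : ℕ) (μ : ℝ) (q : ℕ) (ρ₁ : ℝ) (ρ₂ : ℕ) : Prop :=
  (⌈1 / μ⌉₊ ≤ q ∧ q ≤ K) ∧
  (∃ j : ℕ, q ≤ j ∧ j ≤ K ∧ ρ₁ = (j : ℝ) / (q : ℝ)) ∧
  (⌊(q : ℝ) * μ⌋₊ ≤ ρ₂ ∧ ρ₂ ≤ ⌊(K : ℝ) * μ⌋₊) ∧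
  ρ₁ * (ρ₂ : ℝ) ≤ (K : ℝ) * μ ∧
  (1 / ρ₁) * (K.choose ρ₂ : ℝ) ≤ (K.choose ρ₂ : ℝ) - ((K - q).choose ρ₂ : ℝ) ∧
  ∃ b : ℕ, (b : ℝ) = ρ₁ * (m : ℝ) / (K.choose ρ₂ : ℝ)

/-- A hybrid scheme with parameters `(q, ρ₁, ρ₂)` for `K` edge nodes, `m` model rows over `F`
and `cap` (that is, `m μ`) computations per edge node. -/
structure HybridScheme (F : Type*) [Field F] [DecidableEq F] (K m cap q : ℕ) (ρ₁ : ℝ)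
    (ρ₂ : ℕ) where
  /-- number of coded rows -/
  n : ℕ
  n_eq : (n : ℝ) = ρ₁ * (m : ℝ)
  /-- number of coded rows per set of `ρ₂` edge nodes -/
  b : ℕ
  b_eq : (b : ℝ) = ρ₁ * (m : ℝ) / (K.choose ρ₂ : ℝ)
  /-- coding matrix -/
  G : Matrix (Fin n) (Fin m) F
  mds : IsMDS G
  /-- the set of edge nodes at which a coded row is stored -/
  place : Fin n → Finset (Fin K)
  place_card : ∀ i, (place i).card = ρ₂
  place_even : ∀ T : Finset (Fin K), T.card = ρ₂ →
    (Finset.univ.filter fun i => place i = T).card = b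
  /-- the order in which an edge node processes its rows; its `cap` computations are selected
  from its stored rows and include all of them -/
  sched : Fin K → Fin cap → Fin n
  sched_range : ∀ k, Set.range (sched k) = {i | k ∈ place i}
  /-- the rows whose intermediate values are sent on the downlink, when `T` is the set of edge
  nodes that completed their computations: `m` rows of the largest possible redundancy among
  the rows computed in `T` -/
  send : Finset (Fin K) → Finset (Fin n)
  send_card : ∀ T, q ≤ T.card → (send T).card = m
  send_computed : ∀ T, q ≤ T.card → ∀ i ∈ send T, (place i ∩ T).Nonempty
  send_top : ∀ T, q ≤ T.card → ∀ i ∈ send T, ∀ i' ∉ send T,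
    (place i' ∩ T).card ≤ (place i ∩ T).card

/-! ### Computing phase -/

/-- Number of computations finished by time `t` at an edge node with set-up time `l`, when each
of its `cap` computations takes time `τ`. -/
def numDone (cap : ℕ) (τ l t : ℝ) : ℕ :=
  (Finset.univ.filter fun i : Fin cap => l + τ * ((i : ℝ) + 1) ≤ t).card

/-- Stopping set: at least `q` edge nodes have completed all their computations. -/
def stoppingSet (K cap q : ℕ) : Set (Fin K → ℕ) :=
  {v | (∀ k, v k ≤ cap) ∧ q ≤ (Finset.univ.filter fun k => v k = cap).card}

/-- Duration of the computing phase for the set-up times `l`. -/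
def compTime (K cap q : ℕ) (τ : ℝ) (l : Fin K → ℝ) : ℝ :=
  sInf {t : ℝ | 0 ≤ t ∧ (fun k => numDone cap τ (l k) t) ∈ stoppingSet K cap q}

/-- The edge nodes that have completed all their computations when the computing phase ends. -/
def finished (K cap q : ℕ) (τ : ℝ) (l : Fin K → ℝ) : Finset (Fin K) :=
  Finset.univ.filter fun k => numDone cap τ (l k) (compTime K cap q τ l) = cap

/-! ### Downlink phase -/

/-- Zero-forcing precoder for the square channel matrix `A` (rows: users, columns: transmitters):
the inverse channel, scaled so that the transmit power, for independent unit-power symbols, is at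
most `P` at each transmitter. -/
def zfPrecoder {u : ℕ} (A : Matrix (Fin u) (Fin u) ℂ) (P : ℝ) : Matrix (Fin u) (Fin u) ℂ :=
  ((Real.sqrt (P / ⨆ k, ∑ a, ‖A⁻¹ k a‖ ^ 2) : ℝ) : ℂ) • A⁻¹

/-- Signal-to-interference-plus-noise ratio of user `a` for channel `A`, precoder `V` and
unit-power noise. -/
def sinr {u : ℕ} (A V : Matrix (Fin u) (Fin u) ℂ) (a : Fin u) : ℝ :=
  ‖(A * V) a a‖ ^ 2 / (1 + ∑ a' ∈ Finset.univ.erase a, ‖(A * V) a a'‖ ^ 2)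

/-- Time for delivering `bits` bits to each of the `u` users over channel `A` by zero-forcing. -/
def sessionTime {u : ℕ} (A : Matrix (Fin u) (Fin u) ℂ) (bits P : ℝ) : ℝ :=
  ⨆ a, bits / Real.logb 2 (1 + sinr A (zfPrecoder A P) a)

/-- Channel from the first `min |T| N` edge nodes of `T` to the users
`j, j + 1, …, j + min |T| N - 1` (cyclically). -/
def groupChannel {N K : ℕ} (h : Fin N → Fin K → ℂ) (T : Finset (Fin K)) (j : Fin N) :
    Matrix (Fin (min T.card N)) (Fin (min T.card N)) ℂ :=
  Matrix.of fun a e =>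
    h ⟨((j : ℕ) + (a : ℕ)) % N, Nat.mod_lt _ (Nat.zero_lt_of_lt j.isLt)⟩
      (T.orderEmbOfFin rfl (Fin.castLE (min_le_left _ _) e))

/-- Time for delivering one intermediate value (`L` bits for each of the `N` users) from the set
`T` of edge nodes.  The `N` cyclic groups of `u = min |T| N` users are served one after the other,
with `L / u` bits for each user in a group (each user is in `u` groups); `h j` is the channel in
the block in which group `j` is served. -/
def deliveryTime {N K : ℕ} (L : ℕ) (h : Fin N → Fin N → Fin K → ℂ) (T : Finset (Fin K))
    (P : ℝ) : ℝ :=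
  ∑ j, sessionTime (groupChannel (h j) T j) ((L : ℝ) / ((min T.card N : ℕ) : ℝ)) P

namespace HybridScheme

variable {F : Type*} [Field F] [DecidableEq F] {K m cap q : ℕ} {ρ₁ : ℝ} {ρ₂ : ℕ}

/-- Intermediate value of the coded row `i`: the product of row `i` of `G W` with `X`. -/
def iv (S : HybridScheme F K m cap q ρ₁ ρ₂) {r N : ℕ} (W : Matrix (Fin m) (Fin r) F)
    (X : Matrix (Fin r) (Fin N) F) (i : Fin S.n) : Fin N → F :=
  (S.G * W * X) i

/-- The computation vector `v` is feasible: the intermediate values computed at all the edge nodes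
determine `W X`. -/
def Feasible (S : HybridScheme F K m cap q ρ₁ ρ₂) {r : ℕ} (N : ℕ) (W : Matrix (Fin m) (Fin r) F)
    (v : Fin K → ℕ) : Prop :=
  ∀ X X' : Matrix (Fin r) (Fin N) F,
    (∀ k, ∀ s : Fin cap, (s : ℕ) < v k → S.iv W X (S.sched k s) = S.iv W X' (S.sched k s)) →
    W * X = W * X'

/-- Duration of the downlink phase at power `P`, when `T` is the set of edge nodes that completed
their computations; `h i j` is the channel in the block in which the intermediate value of the
coded row number `i` is sent to the user group `j`. -/
def downTime (S : HybridScheme F K m cap q ρ₁ ρ₂) {N : ℕ} (L : ℕ)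
    (h : ℕ → Fin N → Fin N → Fin K → ℂ) (T : Finset (Fin K)) (P : ℝ) : ℝ :=
  ∑ i ∈ S.send T, deliveryTime L (h i) (S.place i ∩ T) P

/-- Duration of the downlink phase, normalized by the time `N L / log P`. -/
def normDown (S : HybridScheme F K m cap q ρ₁ ρ₂) {N : ℕ} (L : ℕ) (τ : ℝ)
    (l : Fin K → ℝ) (h : ℕ → Fin N → Fin N → Fin K → ℂ) (P : ℝ) : ℝ :=
  S.downTime L h (finished K cap q τ l) P / ((N : ℝ) * (L : ℝ) / Real.logb 2 P)

/-- Normalized computation delay. -/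
def deltaC (_S : HybridScheme F K m cap q ρ₁ ρ₂) (τ : ℝ) (l : Fin K → ℝ) : ℝ :=
  compTime K cap q τ l / τ

/-- Normalized communication delay: the limit of the normalized downlink duration as the power
tends to infinity. -/
def deltaD (S : HybridScheme F K m cap q ρ₁ ρ₂) {N : ℕ} (L : ℕ) (τ : ℝ)
    (l : Fin K → ℝ) (h : ℕ → Fin N → Fin N → Fin K → ℂ) : ℝ :=
  limUnder atTop (S.normDown L τ l h)

/-- Average total normalized latency. -/
def avgLatency (S : HybridScheme F K m cap q ρ₁ ρ₂) {N : ℕ} (L : ℕ) (τ γ : ℝ)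
    {Ω : Type*} [MeasurableSpace Ω] (Pr : Measure Ω) (lam : Fin K → Ω → ℝ)
    (h : ℕ → Fin N → Ω → Fin N → Fin K → ℂ) : ℝ :=
  (∫ ω, S.deltaC τ (fun k => lam k ω) ∂Pr) +
    γ * ∫ ω, S.deltaD L τ (fun k => lam k ω) (fun i j => h i j ω) ∂Pr

end HybridScheme

/-! ### The closed-form latency -/

/-- Smallest redundancy of a computed intermediate value. -/
def rMin (K q ρ₂ : ℕ) : ℕ := max (ρ₂ - (K - q)) 1

/-- Largest redundancy of a computed intermediate value. -/
def rMax (q ρ₂ : ℕ) : ℕ := min q ρ₂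

/-- Number of computed intermediate values of redundancy `r`. -/
def numIV (K m q : ℕ) (ρ₁ : ℝ) (ρ₂ r : ℕ) : ℝ :=
  (q.choose r : ℝ) * ((K - q).choose (ρ₂ - r) : ℝ) * (ρ₁ * (m : ℝ) / (K.choose ρ₂ : ℝ))

/-- The threshold redundancy `r_q`. -/
def rThr (K m q : ℕ) (ρ₁ : ℝ) (ρ₂ : ℕ) : ℕ :=
  sInf {r : ℕ | rMin K q ρ₂ ≤ r ∧
    ∑ i ∈ Finset.Icc r (rMax q ρ₂), numIV K m q ρ₁ ρ₂ i ≤ (m : ℝ)}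

/-- The zero-forcing downlink latency.  If `r_q = 1`, all computed intermediate values are sent
in full, the numerator of the last fraction is zero, and so is the fraction. -/
def zfLatency (K m q : ℕ) (ρ₁ : ℝ) (ρ₂ : ℕ) : ℝ :=
  (∑ r ∈ Finset.Icc (rThr K m q ρ₁ ρ₂) (rMax q ρ₂), numIV K m q ρ₁ ρ₂ r / (r : ℝ)) +
    ((m : ℝ) - ∑ r ∈ Finset.Icc (rThr K m q ρ₁ ρ₂) (rMax q ρ₂), numIV K m q ρ₁ ρ₂ r) /
      ((rThr K m q ρ₁ ρ₂ : ℝ) - 1)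

end

/-!
Decodability is a count. Any `m` rows of a generator matrix of an `(n, m)` MDS code determine the
message (`IsMDS.eq_zero`), and the second condition on the parameters says that the sets of `ρ₂`
edge nodes that meet a given set of `q` nodes carry at least `m` coded rows
(`Admissible.le_card_computed`).

Since the schedules all have the same length, the computing phase ends `τ cap` after the `q`-th
smallest set-up time (`compTime_eq`). The layer-cake formula turns the mean of this order statistic
into the sum over `j < q` of the expected time during which exactly `j` of the `K` exponential
clocks have rung. This is a Beta integral with value `1 / (η (K - j))`, which gives the difference
of harmonic numbers (`integral_orderStat`).

Almost surely the set-up times are distinct, so that exactly `q` nodes finish (`card_finished`), and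
all the channel matrices that occur are invertible (`ae_det_groupChannel_ne_zero`): along lines in a
suitable direction their determinant is a characteristic polynomial, so it vanishes on a null set.
Zero-forcing with an invertible channel gives each user the signal-to-noise ratio `c P` with
`c > 0`, so a value of redundancy `r` costs exactly `1 / r` in the limit (`tendsto_deliveryTime`). The
normalized downlink time thus tends to the sum of the inverse redundancies of the values sent. There
are `B_r` values of redundancy `r`, and a set of `m` values of largest redundancies consists of
those of redundancy at least `r_q` and of others of redundancy `r_q - 1`; the sum is therefore the
closed form (`HybridScheme.sum_inv_redundancy`), and the limit is almost surely constant.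

The latency depends on the scheme only through its parameters. There are finitely many admissible
parameters, and each is realised by a scheme, by the first condition on the parameters
(`Admissible.exists_hybridScheme`), so the minimum exists and is the stated one.
-/

/-! ### Admissible parameters -/

namespace Admissible

variable {K m q ρ₂ : ℕ} {μ ρ₁ : ℝ}

lemma one_le_q_mul (hA : Admissible K m μ q ρ₁ ρ₂) (hμ : 0 < μ) : 1 ≤ (q : ℝ) * μ := by
  have h1 : 1 / μ ≤ q := (Nat.le_ceil _).trans (by exact_mod_cast hA.1.1)
  rwa [div_le_iff₀ hμ] at h1

lemma q_pos (hA : Admissible K m μ q ρ₁ ρ₂) (hμ : 0 < μ) : 0 < q := by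
  rcases Nat.eq_zero_or_pos q with rfl | h
  · have := hA.one_le_q_mul hμ
    norm_num at this
  · exact h

lemma q_le (hA : Admissible K m μ q ρ₁ ρ₂) : q ≤ K := hA.1.2

lemma ρ₂_pos (hA : Admissible K m μ q ρ₁ ρ₂) (hμ : 0 < μ) : 0 < ρ₂ :=
  (Nat.le_floor (by exact_mod_cast hA.one_le_q_mul hμ)).trans hA.2.2.1.1

lemma ρ₂_le_floor (hA : Admissible K m μ q ρ₁ ρ₂) : ρ₂ ≤ ⌊(K : ℝ) * μ⌋₊ := hA.2.2.1.2

lemma ρ₂_le (hA : Admissible K m μ q ρ₁ ρ₂) (hμ1 : μ ≤ 1) : ρ₂ ≤ K :=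
  hA.ρ₂_le_floor.trans <| Nat.floor_le_of_le <| mul_le_of_le_one_right (by positivity) hμ1

lemma ρ₁_pos (hA : Admissible K m μ q ρ₁ ρ₂) (hμ : 0 < μ) : 0 < ρ₁ := by
  obtain ⟨j, hj, -, rfl⟩ := hA.2.1
  have := hA.q_pos hμ
  have : 0 < j := by omega
  positivity

end Admissible

/-! ### Coded rows, their redundancy, and decodability -/

/-- An `s`-set with `r` elements in `T` is the union of an `r`-subset of `T` and an
`(s - r)`-subset of its complement. -/
lemma card_filter_card_inter_eq {α : Type*} [Fintype α] [DecidableEq α] (T : Finset α) {r s : ℕ}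
    (hrs : r ≤ s) :
    (Finset.univ.filter fun A : Finset α => A.card = s ∧ (A ∩ T).card = r).card =
      T.card.choose r * (Fintype.card α - T.card).choose (s - r) := by
  rw [← Finset.card_compl, ← Finset.card_powersetCard r T,
    ← Finset.card_powersetCard (s - r) Tᶜ, ← Finset.card_product]
  refine Finset.card_nbij' (fun A => (A ∩ T, A \ T)) (fun p => p.1 ∪ p.2) ?_ ?_ ?_ ?_
  · intro A hA
    simp only [Finset.coe_filter, Finset.mem_univ, true_and, Set.mem_ofPred_eq] at hA
    have := Finset.card_inter_add_card_sdiff A T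
    simp only [Finset.coe_product, Set.mem_prod, Finset.mem_coe, Finset.mem_powersetCard,
      Finset.inter_subset_right, true_and, hA.2]
    exact ⟨fun x hx => by simpa using (Finset.mem_sdiff.1 hx).2, by omega⟩
  · rintro ⟨B, C⟩ h
    simp only [Finset.coe_product, Set.mem_prod, Finset.mem_coe, Finset.mem_powersetCard] at h
    obtain ⟨⟨hB, hBr⟩, hC, hCs⟩ := h
    have hCT : Disjoint C T := by
      rw [Finset.disjoint_left]
      exact fun x hx => by simpa using hC hx
    have hBC : Disjoint B C := (hCT.mono_right hB).symm
    simp only [Finset.coe_filter, Finset.mem_univ, true_and, Set.mem_ofPred_eq]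
    rw [Finset.card_union_of_disjoint hBC, Finset.union_inter_distrib_right,
      Finset.inter_eq_left.2 hB, Finset.disjoint_iff_inter_eq_empty.1 hCT, Finset.union_empty]
    omega
  · intro A _
    exact (Finset.union_comm _ _).trans (Finset.sdiff_union_inter A T)
  · rintro ⟨B, C⟩ h
    simp only [Finset.coe_product, Set.mem_prod, Finset.mem_coe, Finset.mem_powersetCard] at h
    obtain ⟨⟨hB, -⟩, hC, -⟩ := h
    ext x
    · have := @hB x
      have := @hC x
      simp only [Finset.mem_inter, Finset.mem_union, Finset.mem_compl] at *
      tauto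
    · have := @hB x
      have := @hC x
      simp only [Finset.mem_sdiff, Finset.mem_union, Finset.mem_compl] at *
      tauto

lemma card_filter_inter_nonempty {α : Type*} [Fintype α] [DecidableEq α] (T : Finset α) (s : ℕ) :
    (Finset.univ.filter fun A : Finset α => A.card = s ∧ (A ∩ T).Nonempty).card +
      (Fintype.card α - T.card).choose s = (Fintype.card α).choose s := by
  have h0 := card_filter_card_inter_eq T (Nat.zero_le s)
  rw [Nat.choose_zero_right, one_mul, Nat.sub_zero] at h0
  rw [← h0, ← Finset.card_univ, ← Finset.card_powersetCard s Finset.univ,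
    ← Finset.card_union_of_disjoint]
  · congr 1
    ext A
    simp only [Finset.mem_union, Finset.mem_filter, Finset.mem_univ, true_and,
      Finset.mem_powersetCard, Finset.subset_univ, Finset.card_eq_zero,
      Finset.nonempty_iff_ne_empty]
    tauto
  · rw [Finset.disjoint_left]
    simp only [Finset.mem_filter, Finset.mem_univ, true_and, Finset.card_eq_zero,
      Finset.nonempty_iff_ne_empty]
    tauto

/-- Any `m` coordinates of a codeword of a maximum distance separable code of dimension `m`
determine the message. -/
lemma IsMDS.eq_zero {F : Type*} [Field F] [DecidableEq F] {n m : ℕ}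
    {G : Matrix (Fin n) (Fin m) F} (hG : IsMDS G) {s : Finset (Fin n)} (hs : m ≤ s.card)
    {v : Fin m → F} (hv : ∀ i ∈ s, G.mulVec v i = 0) : v = 0 := by
  by_contra hne
  have h1 := hG v hne
  have h2 : hammingNorm (G.mulVec v) ≤ sᶜ.card := by
    refine Finset.card_le_card fun i hi => ?_
    simp only [Finset.mem_filter, Finset.mem_univ, true_and] at hi
    exact Finset.mem_compl.2 fun his => hi (hv i his)
  rw [Finset.card_compl, Fintype.card_fin] at h2
  have := s.card_le_univ
  rw [Fintype.card_fin] at this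
  omega

/-- If every `A` with `A.card = ρ₂` is the value of `b` arguments of `place`, then counting
arguments reduces to counting sets. -/
lemma card_filter_place {n K ρ₂ b : ℕ} {place : Fin n → Finset (Fin K)}
    (hcard : ∀ i, (place i).card = ρ₂)
    (heven : ∀ T : Finset (Fin K), T.card = ρ₂ →
      (Finset.univ.filter fun i => place i = T).card = b)
    (p : Finset (Fin K) → Prop) [DecidablePred p] :
    (Finset.univ.filter fun i => p (place i)).card =
      (Finset.univ.filter fun A : Finset (Fin K) => A.card = ρ₂ ∧ p A).card * b := by
  rw [Finset.card_eq_sum_card_fiberwise (f := place)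
    (t := Finset.univ.filter fun A : Finset (Fin K) => A.card = ρ₂ ∧ p A)]
  · refine Finset.sum_const_nat fun A hA => ?_
    simp only [Finset.mem_filter, Finset.mem_univ, true_and] at hA
    rw [← heven A hA.1, Finset.filter_filter]
    congr 1
    ext i
    simp only [Finset.mem_filter, Finset.mem_univ, true_and]
    exact ⟨fun h => h.2, fun h => ⟨h ▸ hA.2, h⟩⟩
  · intro i hi
    simp only [Finset.coe_filter, Finset.mem_univ, true_and, Set.mem_ofPred_eq] at hi ⊢
    exact ⟨hcard i, hi⟩

/-- Any `q` edge nodes store at least `m` different coded rows: all but `(K - q).choose ρ₂` of the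
sets of `ρ₂` edge nodes meet them. -/
lemma Admissible.le_card_computed {K m q ρ₂ : ℕ} {μ ρ₁ : ℝ} (hA : Admissible K m μ q ρ₁ ρ₂)
    (hμ : 0 < μ) (hμ1 : μ ≤ 1) {n b : ℕ} (hb : (b : ℝ) = ρ₁ * (m : ℝ) / (K.choose ρ₂ : ℝ))
    {place : Fin n → Finset (Fin K)} (hcard : ∀ i, (place i).card = ρ₂)
    (heven : ∀ T : Finset (Fin K), T.card = ρ₂ →
      (Finset.univ.filter fun i => place i = T).card = b)
    {T : Finset (Fin K)} (hT : q ≤ T.card) :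
    m ≤ (Finset.univ.filter fun i => (place i ∩ T).Nonempty).card := by
  rw [card_filter_place hcard heven fun A => (A ∩ T).Nonempty]
  have h1 := card_filter_inter_nonempty T ρ₂
  rw [Fintype.card_fin] at h1
  set c := (Finset.univ.filter fun A : Finset (Fin K) => A.card = ρ₂ ∧ (A ∩ T).Nonempty).card
  have h2 : (K - T.card).choose ρ₂ ≤ (K - q).choose ρ₂ := Nat.choose_le_choose _ (by omega)
  have h3 : (K.choose ρ₂ : ℝ) ≤ c + ((K - q).choose ρ₂ : ℕ) := by
    rw [← h1]; push_cast; gcongr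
  have h4 := hA.2.2.2.2.1
  have h5 : (1 / ρ₁) * (K.choose ρ₂ : ℝ) ≤ c := by linarith
  have hρ := hA.ρ₁_pos hμ
  have hC : (0 : ℝ) < K.choose ρ₂ := by exact_mod_cast Nat.choose_pos (hA.ρ₂_le hμ1)
  have h6 : (m : ℝ) ≤ c * b := by
    calc (m : ℝ) = (1 / ρ₁) * (K.choose ρ₂ : ℝ) * b := by rw [hb]; field_simp
      _ ≤ c * b := by gcongr
  exact_mod_cast h6

namespace HybridScheme

variable {F : Type*} [Field F] [DecidableEq F] {K m cap q : ℕ} {ρ₁ : ℝ} {ρ₂ : ℕ}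
  (S : HybridScheme F K m cap q ρ₁ ρ₂)

lemma mul_eq_of_iv_eq {r N : ℕ} {W : Matrix (Fin m) (Fin r) F} {X X' : Matrix (Fin r) (Fin N) F}
    {s : Finset (Fin S.n)} (hs : m ≤ s.card) (h : ∀ i ∈ s, S.iv W X i = S.iv W X' i) :
    W * X = W * X' := by
  ext a c
  have key : (fun a => (W * X - W * X') a c) = 0 := by
    refine S.mds.eq_zero hs fun i hi => ?_
    have h1 : (S.G * (W * X - W * X')) i c = 0 := by
      have := congrFun (h i hi) c
      simp only [iv, Matrix.mul_assoc] at this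
      rw [Matrix.mul_sub, Matrix.sub_apply, this, sub_self]
    simpa [Matrix.mul_apply, Matrix.mulVec, dotProduct] using h1
  have := congrFun key a
  simpa [sub_eq_zero] using this

lemma feasible_of_mem_stoppingSet {μ : ℝ} (hA : Admissible K m μ q ρ₁ ρ₂) (hμ : 0 < μ)
    (hμ1 : μ ≤ 1) {r : ℕ} (N : ℕ) (W : Matrix (Fin m) (Fin r) F) {v : Fin K → ℕ}
    (hv : v ∈ stoppingSet K cap q) : S.Feasible N W v := by
  intro X X' h
  refine S.mul_eq_of_iv_eq (hA.le_card_computed hμ hμ1 S.b_eq S.place_card S.place_even hv.2)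
    fun i hi => ?_
  simp only [Finset.mem_filter, Finset.mem_univ, true_and] at hi
  obtain ⟨k, hk⟩ := hi
  simp only [Finset.mem_inter, Finset.mem_filter, Finset.mem_univ, true_and] at hk
  have hik : i ∈ Set.range (S.sched k) := by
    rw [S.sched_range]; exact hk.1
  obtain ⟨s, rfl⟩ := hik
  exact h k s (hk.2 ▸ s.isLt)

end HybridScheme

/-! ### The redundancies of the values sent -/

/-- A set `s` of arguments with the largest values of `f` consists of all `i` with `R ≤ f i` and of
some `i` with `f i = R - 1`, where `R` is the least threshold, from `lo` on, that at most `s.card`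
arguments reach.  If `R = 1` the last term is read as `0`, in accordance with `1 / f i = 0` for
`f i = 0`. -/
lemma sum_inv_eq_of_largest {ι : Type*} [Fintype ι] [DecidableEq ι] (f : ι → ℕ) (s : Finset ι)
    {lo R : ℕ} (hlo : ∀ i ∈ s, lo ≤ f i) (htop : ∀ i ∈ s, ∀ i' ∉ s, f i' ≤ f i)
    (hR : (Finset.univ.filter fun i => R ≤ f i).card ≤ s.card)
    (hmin : ∀ r, lo ≤ r → r < R → s.card < (Finset.univ.filter fun i => r ≤ f i).card) :
    ∑ i ∈ s, 1 / (f i : ℝ) = ∑ i with R ≤ f i, 1 / (f i : ℝ) +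
      ((s.card : ℝ) - ((Finset.univ.filter fun i => R ≤ f i).card : ℝ)) / ((R : ℝ) - 1) := by
  set U := Finset.univ.filter fun i => R ≤ f i with hU
  have hUs : U ⊆ s := by
    intro i hi
    by_contra his
    have hsU : s ⊆ U := fun j hj => by
      simp only [hU, Finset.mem_filter, Finset.mem_univ, true_and] at hi ⊢
      exact hi.trans (htop j hj i his)
    exact his (Finset.eq_of_subset_of_card_le hsU hR ▸ hi)
  have hval : ∀ i ∈ s \ U, 1 / (f i : ℝ) = 1 / ((R : ℝ) - 1) := by
    intro i hi
    simp only [hU, Finset.mem_sdiff, Finset.mem_filter, Finset.mem_univ, true_and, not_le] at hi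
    obtain ⟨his, hiR⟩ := hi
    -- otherwise some `i'` outside `s` reaches the threshold `R - 1` although `f i` does not
    have hfi : f i = R - 1 := by
      by_contra hne
      have hlt := hmin (R - 1) (by have := hlo i his; omega) (by omega)
      obtain ⟨i', hi', hi's⟩ := Finset.exists_mem_notMem_of_card_lt_card hlt
      simp only [Finset.mem_filter, Finset.mem_univ, true_and] at hi'
      have := htop i his i' hi's
      omega
    rw [hfi, Nat.cast_sub (by omega), Nat.cast_one]
  rw [← Finset.sum_sdiff hUs, Finset.sum_congr rfl hval, Finset.sum_const, nsmul_eq_mul,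
    Finset.card_sdiff_of_subset hUs, Nat.cast_sub hR, add_comm]
  ring

lemma sum_with_le_eq_sum_Icc {ι : Type*} [Fintype ι] (f : ι → ℕ) {R hi : ℕ}
    (hhi : ∀ i, f i ≤ hi) (g : ℕ → ℝ) :
    ∑ i with R ≤ f i, g (f i) =
      ∑ r ∈ Finset.Icc R hi, ((Finset.univ.filter fun i => f i = r).card : ℝ) * g r := by
  rw [← Finset.sum_fiberwise_of_maps_to (t := Finset.Icc R hi) (g := f)]
  · refine Finset.sum_congr rfl fun r hr => ?_
    rw [Finset.filter_filter, Finset.sum_congr rfl (g := fun _ => g r), Finset.sum_const,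
      nsmul_eq_mul]
    · congr 3
      ext i
      simp only [Finset.mem_filter, Finset.mem_univ, true_and, and_iff_right_iff_imp]
      exact fun h => h ▸ (Finset.mem_Icc.1 hr).1
    · intro i hi
      rw [(Finset.mem_filter.1 hi).2.2]
  · intro i hi
    exact Finset.mem_Icc.2 ⟨(Finset.mem_filter.1 hi).2, hhi i⟩

lemma numIV_eq_card {K m q ρ₂ n b : ℕ} {ρ₁ : ℝ}
    (hb : (b : ℝ) = ρ₁ * (m : ℝ) / (K.choose ρ₂ : ℝ))
    {place : Fin n → Finset (Fin K)} (hcard : ∀ i, (place i).card = ρ₂)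
    (heven : ∀ T : Finset (Fin K), T.card = ρ₂ →
      (Finset.univ.filter fun i => place i = T).card = b)
    {T : Finset (Fin K)} (hT : T.card = q) {r : ℕ} (hr : r ≤ ρ₂) :
    ((Finset.univ.filter fun i => (place i ∩ T).card = r).card : ℝ) = numIV K m q ρ₁ ρ₂ r := by
  rw [card_filter_place hcard heven fun A => (A ∩ T).card = r, card_filter_card_inter_eq T hr,
    Fintype.card_fin, hT, numIV, ← hb]
  push_cast
  ring

/-- With `q` edge nodes, the inverse redundancies of the values sent add up to the closed form of
the downlink latency. -/
lemma HybridScheme.sum_inv_redundancy {F : Type*} [Field F] [DecidableEq F] {K m cap q : ℕ}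
    {ρ₁ : ℝ} {ρ₂ : ℕ} (S : HybridScheme F K m cap q ρ₁ ρ₂) {T : Finset (Fin K)}
    (hT : T.card = q) :
    ∑ i ∈ S.send T, 1 / ((S.place i ∩ T).card : ℝ) = zfLatency K m q ρ₁ ρ₂ := by
  set f : Fin S.n → ℕ := fun i => (S.place i ∩ T).card with hf
  have hfmax : ∀ i, f i ≤ rMax q ρ₂ := fun i =>
    le_min (hT ▸ Finset.card_le_card Finset.inter_subset_right)
      (S.place_card i ▸ Finset.card_le_card Finset.inter_subset_left)
  have hnum : ∀ r ≤ rMax q ρ₂,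
      ((Finset.univ.filter fun i => f i = r).card : ℝ) = numIV K m q ρ₁ ρ₂ r := fun r hr =>
    numIV_eq_card S.b_eq S.place_card S.place_even hT (hr.trans (min_le_right _ _))
  have hcount : ∀ r, ((Finset.univ.filter fun i => r ≤ f i).card : ℝ) =
      ∑ i ∈ Finset.Icc r (rMax q ρ₂), numIV K m q ρ₁ ρ₂ i := by
    intro r
    have := sum_with_le_eq_sum_Icc f hfmax (R := r) fun _ => 1
    simp only [Finset.sum_const, nsmul_eq_mul, mul_one] at this
    rw [this]
    exact Finset.sum_congr rfl fun i hi => hnum i (Finset.mem_Icc.1 hi).2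
  have hcard := S.send_card T hT.ge
  have hne : {r : ℕ | rMin K q ρ₂ ≤ r ∧
      ∑ i ∈ Finset.Icc r (rMax q ρ₂), numIV K m q ρ₁ ρ₂ i ≤ (m : ℝ)}.Nonempty := by
    refine ⟨max (rMin K q ρ₂) (rMax q ρ₂ + 1), le_max_left _ _, ?_⟩
    rw [Finset.Icc_eq_empty (by simp), Finset.sum_empty]
    positivity
  have hmem := Nat.sInf_mem hne
  have key := sum_inv_eq_of_largest f (S.send T) (lo := rMin K q ρ₂) (R := rThr K m q ρ₁ ρ₂)
    ?_ (S.send_top T hT.ge) ?_ ?_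
  · rw [key, zfLatency, hcount, hcard, sum_with_le_eq_sum_Icc f hfmax fun r => 1 / (r : ℝ)]
    congr 1
    refine Finset.sum_congr rfl fun r hr => ?_
    rw [hnum r (Finset.mem_Icc.1 hr).2]
    ring
  · intro i hi
    refine max_le ?_ (Finset.card_pos.2 (S.send_computed T hT.ge i hi))
    have h1 := Finset.card_union_add_card_inter (S.place i) T
    have h2 := (S.place i ∪ T).card_le_univ
    rw [S.place_card, hT] at h1
    rw [Fintype.card_fin] at h2
    simp only [hf]
    omega
  · rw [hcard, ← Nat.cast_le (α := ℝ), hcount]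
    exact hmem.2
  · intro r hr hlt
    rw [hcard, ← Nat.cast_lt (α := ℝ), hcount]
    by_contra hle
    exact Nat.notMem_of_lt_sInf hlt ⟨hr, not_lt.1 hle⟩

/-! ### Existence of a scheme -/

lemma exists_subset_card_eq_largest {ι : Type*} [DecidableEq ι] (f : ι → ℕ) (C : Finset ι) {m : ℕ}
    (hm : m ≤ C.card) :
    ∃ s ⊆ C, s.card = m ∧ ∀ i ∈ s, ∀ i' ∈ C, i' ∉ s → f i' ≤ f i := by
  induction m with
  | zero => exact ⟨∅, by simp, by simp, by simp⟩
  | succ m ih =>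
    obtain ⟨s, hsC, hsm, hs⟩ := ih (by omega)
    have hne : (C \ s).Nonempty := by
      rw [← Finset.card_pos, Finset.card_sdiff_of_subset hsC]; omega
    obtain ⟨a, ha, hmax⟩ := Finset.exists_max_image (C \ s) f hne
    rw [Finset.mem_sdiff] at ha
    refine ⟨insert a s, Finset.insert_subset ha.1 hsC, by
      rw [Finset.card_insert_of_notMem ha.2, hsm], fun i hi i' hi' hn => ?_⟩
    rw [Finset.mem_insert, not_or] at hn
    rcases Finset.mem_insert.1 hi with rfl | hi
    · exact hmax i' (Finset.mem_sdiff.2 ⟨hi', hn.2⟩)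
    · exact hs i hi i' hi' hn.2

/-- Each edge node can fill its `c` computations with its stored rows, some of them repeated. -/
lemma exists_range_eq_of_card_le {α : Type*} {s : Finset α} (hs : s.Nonempty) {c : ℕ}
    (hc : s.card ≤ c) : ∃ f : Fin c → α, Set.range f = s := by
  have : Nonempty s := hs.to_subtype
  obtain ⟨e⟩ : Nonempty (s ↪ Fin c) := Function.Embedding.nonempty_of_card_le (by simpa using hc)
  refine ⟨fun i => (Function.invFun e i : s), ?_⟩
  rw [Set.range_comp' Subtype.val, (Function.invFun_surjective e.injective).range_eq]
  simp

/-- Each set of `ρ₂` edge nodes is given its own `b` coded rows. An edge node then stores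
`b * (K - 1).choose (ρ₂ - 1) = ρ₁ ρ₂ m / K` of them, at most its capacity as `ρ₁ ρ₂ ≤ K μ`. -/
lemma Admissible.exists_hybridScheme {F : Type*} [Field F] [DecidableEq F] {K m cap q ρ₂ : ℕ}
    {μ ρ₁ : ℝ} (hA : Admissible K m μ q ρ₁ ρ₂) (hm : 0 < m) (hμ : 0 < μ) (hμ1 : μ ≤ 1)
    (hcap : (cap : ℝ) = (m : ℝ) * μ)
    (hMDS : ∀ n : ℕ, (n : ℝ) = ρ₁ * (m : ℝ) → ∃ G : Matrix (Fin n) (Fin m) F, IsMDS G) :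
    Nonempty (HybridScheme F K m cap q ρ₁ ρ₂) := by
  obtain ⟨b, hb⟩ := hA.2.2.2.2.2
  have hρ₁ := hA.ρ₁_pos hμ
  have hρ₂ := hA.ρ₂_pos hμ
  have hρ₂K := hA.ρ₂_le hμ1
  have hC : 0 < K.choose ρ₂ := Nat.choose_pos hρ₂K
  have hC' : (0 : ℝ) < K.choose ρ₂ := by exact_mod_cast hC
  have hn : ((K.choose ρ₂ * b : ℕ) : ℝ) = ρ₁ * (m : ℝ) := by
    push_cast; rw [hb]; field_simp
  have hb0 : 0 < b := by
    rw [← Nat.cast_pos (α := ℝ), hb]; positivity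
  obtain ⟨G, hG⟩ := hMDS _ hn
  let e : Fin (K.choose ρ₂ * b) ≃
      {A : Finset (Fin K) // A ∈ Finset.powersetCard ρ₂ Finset.univ} × Fin b :=
    Fintype.equivOfCardEq (by
      rw [Fintype.card_prod, Fintype.card_coe, Finset.card_powersetCard, Finset.card_univ]; simp)
  let place : Fin (K.choose ρ₂ * b) → Finset (Fin K) := fun i => (e i).1
  have hcard : ∀ i, (place i).card = ρ₂ := fun i => (Finset.mem_powersetCard.1 (e i).1.2).2
  have heven : ∀ T : Finset (Fin K), T.card = ρ₂ →
      (Finset.univ.filter fun i => place i = T).card = b := by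
    intro T hT
    have hTm : T ∈ Finset.powersetCard ρ₂ Finset.univ :=
      Finset.mem_powersetCard.2 ⟨Finset.subset_univ _, hT⟩
    suffices h : (Finset.univ.filter fun i => place i = T).card =
        (Finset.univ : Finset (Fin b)).card by
      rw [h, Finset.card_univ, Fintype.card_fin]
    refine Finset.card_nbij' (fun i => (e i).2) (fun j => e.symm (⟨T, hTm⟩, j)) ?_ ?_ ?_ ?_
    · simp
    · simp [place]
    · intro i hi
      simp only [Finset.coe_filter, Finset.mem_univ, true_and, Set.mem_ofPred_eq] at hi
      rw [Equiv.symm_apply_eq]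
      exact Prod.ext (Subtype.ext hi.symm) rfl
    · intro j _
      simp
  have hstored : ∀ k, (Finset.univ.filter fun i => k ∈ place i).card =
      (K - 1).choose (ρ₂ - 1) * b := by
    intro k
    rw [card_filter_place hcard heven fun A => k ∈ A]
    have h1 := card_filter_card_inter_eq ({k} : Finset (Fin K)) (r := 1) (s := ρ₂) hρ₂
    rw [Finset.card_singleton, Nat.choose_self, one_mul, Fintype.card_fin] at h1
    rw [← h1]
    congr 3
    ext A
    by_cases hk : k ∈ A <;> simp [hk]
  have hsched : ∀ k, ∃ f : Fin cap → Fin (K.choose ρ₂ * b), Set.range f = {i | k ∈ place i} := by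
    intro k
    have hfit : (K - 1).choose (ρ₂ - 1) * b ≤ cap := by
      obtain ⟨K', rfl⟩ : ∃ K', K = K' + 1 := ⟨K - 1, by omega⟩
      obtain ⟨t, rfl⟩ : ∃ t, ρ₂ = t + 1 := ⟨ρ₂ - 1, by omega⟩
      have h1 : ((K' + 1 : ℕ) : ℝ) * (K'.choose t : ℝ) =
          ((K' + 1).choose (t + 1) : ℝ) * ((t + 1 : ℕ) : ℝ) := by
        exact_mod_cast Nat.add_one_mul_choose_eq K' t
      have h2 := hA.2.2.2.1
      have h3 : (0 : ℝ) < ((K' + 1 : ℕ) : ℝ) := by positivity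
      simp only [Nat.add_sub_cancel]
      rw [← Nat.cast_le (α := ℝ), hcap]
      refine le_of_mul_le_mul_left ?_ h3
      calc ((K' + 1 : ℕ) : ℝ) * ((K'.choose t * b : ℕ) : ℝ)
          = ((K' + 1 : ℕ) : ℝ) * (K'.choose t : ℝ) * b := by push_cast; ring
        _ = (((K' + 1).choose (t + 1) * b : ℕ) : ℝ) * ((t + 1 : ℕ) : ℝ) := by
            rw [h1]; push_cast; ring
        _ = (ρ₁ * ((t + 1 : ℕ) : ℝ)) * m := by rw [hn]; ring
        _ ≤ ((K' + 1 : ℕ) : ℝ) * μ * m := by gcongr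
        _ = ((K' + 1 : ℕ) : ℝ) * (m * μ) := by ring
    obtain ⟨f, hf⟩ := exists_range_eq_of_card_le (s := Finset.univ.filter fun i => k ∈ place i)
      (Finset.card_pos.1 (by
        rw [hstored]; exact Nat.mul_pos (Nat.choose_pos (by omega)) hb0)) (c := cap)
      (by rw [hstored]; exact hfit)
    exact ⟨f, by rw [hf]; simp⟩
  choose sched hsched using hsched
  have hsend : ∀ T : Finset (Fin K), ∃ s : Finset (Fin (K.choose ρ₂ * b)), q ≤ T.card →
      s.card = m ∧ (∀ i ∈ s, (place i ∩ T).Nonempty) ∧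
        ∀ i ∈ s, ∀ i' ∉ s, (place i' ∩ T).card ≤ (place i ∩ T).card := by
    intro T
    by_cases hT : q ≤ T.card
    · obtain ⟨s, hsC, hsm, hs⟩ := exists_subset_card_eq_largest (fun i => (place i ∩ T).card) _
        (hA.le_card_computed hμ hμ1 hb hcard heven hT)
      refine ⟨s, fun _ => ⟨hsm, fun i hi => by simpa using hsC hi, fun i hi i' hi' => ?_⟩⟩
      by_cases hne : (place i' ∩ T).Nonempty
      · exact hs i hi i' (by simpa using hne) hi'
      · rw [Finset.not_nonempty_iff_eq_empty.1 hne]; simp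
    -- the structure asks nothing of `send T` for sets of fewer than `q` edge nodes
    · exact ⟨∅, fun h => absurd h hT⟩
  choose send hsend using hsend
  exact ⟨{
    n := K.choose ρ₂ * b
    n_eq := hn
    b := b
    b_eq := hb
    G := G
    mds := hG
    place := place
    place_card := hcard
    place_even := heven
    sched := sched
    sched_range := hsched
    send := send
    send_card := fun T hT => (hsend T hT).1
    send_computed := fun T hT => (hsend T hT).2.1
    send_top := fun T hT => (hsend T hT).2.2 }⟩

/-! ### Order statistics and the computing phase -/

/-- The `q`-th smallest of the numbers `l k`: the least maximum of `l` over a `q`-set. -/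
noncomputable def orderStat {K : ℕ} (q : ℕ) (hq : 0 < q) (hqK : q ≤ K) (l : Fin K → ℝ) : ℝ :=
  (Finset.powersetCard q (Finset.univ : Finset (Fin K))).attach.inf'
    (Finset.attach_nonempty_iff.2 (Finset.powersetCard_nonempty.2 (by
      rwa [Finset.card_univ, Fintype.card_fin])))
    fun A => A.1.sup' (Finset.card_pos.1 (by rwa [(Finset.mem_powersetCard.1 A.2).2])) l

lemma orderStat_le_iff {K q : ℕ} (hq : 0 < q) (hqK : q ≤ K) (l : Fin K → ℝ) (s : ℝ) :
    orderStat q hq hqK l ≤ s ↔ q ≤ (Finset.univ.filter fun k => l k ≤ s).card := by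
  simp only [orderStat, Finset.inf'_le_iff, Finset.mem_attach, true_and, Finset.sup'_le_iff,
    Subtype.exists, Finset.mem_powersetCard, Finset.subset_univ]
  constructor
  · rintro ⟨A, hA, h⟩
    rw [← hA]
    exact Finset.card_le_card fun k hk => by simpa using h k hk
  · intro h
    obtain ⟨A, hA, hAq⟩ := Finset.exists_subset_card_eq h
    exact ⟨A, hAq, fun k hk => by simpa using hA hk⟩

lemma measurable_orderStat {K q : ℕ} (hq : 0 < q) (hqK : q ≤ K) :
    Measurable (orderStat q hq hqK) := by
  refine measurable_of_Iic fun s => ?_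
  have : orderStat q hq hqK ⁻¹' Set.Iic s =
      ⋃ A ∈ Finset.powersetCard q (Finset.univ : Finset (Fin K)), ⋂ k ∈ A,
        {l : Fin K → ℝ | l k ≤ s} := by
    ext l
    simp only [Set.mem_preimage, Set.mem_Iic, orderStat_le_iff, Set.mem_iUnion, Set.mem_iInter,
      Finset.mem_powersetCard, Finset.subset_univ, true_and, exists_prop, Set.mem_ofPred_eq]
    constructor
    · intro h
      obtain ⟨A, hA, hAq⟩ := Finset.exists_subset_card_eq h
      exact ⟨A, hAq, fun k hk => by simpa using hA hk⟩
    · rintro ⟨A, hA, h⟩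
      rw [← hA]
      exact Finset.card_le_card fun k hk => by simpa using h k hk
  rw [this]
  exact Finset.measurableSet_biUnion _ fun A _ => Finset.measurableSet_biInter _ fun k _ =>
    measurableSet_le (measurable_pi_apply k) measurable_const

lemma orderStat_nonneg {K q : ℕ} (hq : 0 < q) (hqK : q ≤ K) {l : Fin K → ℝ} (hl : ∀ k, 0 ≤ l k) :
    0 ≤ orderStat q hq hqK l := by
  have h1 := (orderStat_le_iff hq hqK l _).1 le_rfl
  obtain ⟨k, hk⟩ := Finset.card_pos.1 (hq.trans_le h1)
  exact (hl k).trans (Finset.mem_filter.1 hk).2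

lemma card_filter_le_orderStat {K q : ℕ} (hq : 0 < q) (hqK : q ≤ K) {l : Fin K → ℝ}
    (hl : Function.Injective l) :
    (Finset.univ.filter fun k => l k ≤ orderStat q hq hqK l).card = q := by
  refine le_antisymm ?_ ((orderStat_le_iff hq hqK l _).1 le_rfl)
  set s := orderStat q hq hqK l with hs
  by_contra! hlt
  -- at most one `k` attains `s`, so at least `q` of the values lie strictly below `s`
  have hlt' : q ≤ (Finset.univ.filter fun k => l k < s).card := by
    have h1 : (Finset.univ.filter fun k => l k = s).card ≤ 1 :=
      Finset.card_le_one.2 fun a ha b hb => hl (by simp_all)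
    have h2 : (Finset.univ.filter fun k => l k ≤ s).card ≤
        (Finset.univ.filter fun k => l k < s).card + (Finset.univ.filter fun k => l k = s).card := by
      rw [← Finset.card_union_of_disjoint]
      · exact Finset.card_le_card fun k hk => by simpa [le_iff_lt_or_eq] using hk
      · rw [Finset.disjoint_left]
        intro k hk hk'
        simp only [Finset.mem_filter, Finset.mem_univ, true_and] at hk hk'
        exact hk.ne hk'
    omega
  -- the largest of these is then an upper bound for the order statistic `s`
  obtain ⟨k, hk, hmax⟩ := Finset.exists_max_image (Finset.univ.filter fun k => l k < s) l
    (Finset.card_pos.1 (hq.trans_le hlt'))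
  have h3 : s ≤ l k := (orderStat_le_iff hq hqK l _).2 <| hlt'.trans <|
    Finset.card_le_card fun j hj => by simpa using hmax j hj
  exact absurd (Finset.mem_filter.1 hk).2 (not_lt.2 h3)

lemma numDone_le (cap : ℕ) (τ l t : ℝ) : numDone cap τ l t ≤ cap :=
  (Finset.card_filter_le _ _).trans (by simp)

lemma numDone_eq_iff {cap : ℕ} (hcap : 0 < cap) {τ : ℝ} (hτ : 0 < τ) (l t : ℝ) :
    numDone cap τ l t = cap ↔ l + τ * cap ≤ t := by
  have hall : numDone cap τ l t = cap ↔ ∀ i : Fin cap, l + τ * ((i : ℝ) + 1) ≤ t := by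
    have := Finset.card_filter_eq_iff (s := (Finset.univ : Finset (Fin cap)))
      (p := fun i : Fin cap => l + τ * ((i : ℝ) + 1) ≤ t)
    simpa [numDone] using this
  rw [hall]
  constructor
  · intro h
    have := h ⟨cap - 1, by omega⟩
    rwa [Nat.cast_sub hcap, Nat.cast_one, sub_add_cancel] at this
  · intro h i
    have h1 : ((i : ℕ) : ℝ) + 1 ≤ cap := by exact_mod_cast i.isLt
    have h2 : τ * ((i : ℝ) + 1) ≤ τ * cap := by gcongr
    linarith

/-- The computing phase consists of the wait for the `q`-th smallest set-up time and of one full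
schedule. -/
lemma compTime_eq {K cap q : ℕ} (hq : 0 < q) (hqK : q ≤ K) (hcap : 0 < cap) {τ : ℝ} (hτ : 0 < τ)
    {l : Fin K → ℝ} (hl : ∀ k, 0 ≤ l k) :
    compTime K cap q τ l = orderStat q hq hqK l + τ * cap := by
  have hset : {t : ℝ | 0 ≤ t ∧ (fun k => numDone cap τ (l k) t) ∈ stoppingSet K cap q} =
      Set.Ici (orderStat q hq hqK l + τ * cap) := by
    ext t
    have h0 := orderStat_nonneg hq hqK hl
    have h1 : 0 ≤ τ * cap := by positivity
    simp only [Set.mem_ofPred_eq, stoppingSet, numDone_le, implies_true, true_and,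
      numDone_eq_iff hcap hτ, Set.mem_Ici, ← le_sub_iff_add_le, ← orderStat_le_iff hq hqK]
    exact ⟨fun h => h.2, fun h => ⟨by linarith, h⟩⟩
  rw [compTime, hset, csInf_Ici]

/-- If the set-up times are distinct, no more than `q` edge nodes finish in time. -/
lemma card_finished {K cap q : ℕ} (hq : 0 < q) (hqK : q ≤ K) (hcap : 0 < cap) {τ : ℝ} (hτ : 0 < τ)
    {l : Fin K → ℝ} (hl : ∀ k, 0 ≤ l k) (hinj : Function.Injective l) :
    (finished K cap q τ l).card = q := by
  rw [finished, compTime_eq hq hqK hcap hτ hl]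
  simp only [numDone_eq_iff hcap hτ, add_le_add_iff_right]
  exact card_filter_le_orderStat hq hqK hinj

/-! ### Exponential set-up times -/

lemma expMeasure_Ioi {η : ℝ} (hη : 0 < η) {t : ℝ} (ht : 0 ≤ t) :
    (expMeasure η).real (Set.Ioi t) = Real.exp (-(η * t)) := by
  have := isProbabilityMeasure_expMeasure hη
  rw [← Set.compl_Iic, probReal_compl_eq_one_sub measurableSet_Iic, ← cdf_eq_real,
    cdf_expMeasure_eq hη, if_pos ht]
  ring

lemma expMeasure_Iic {η : ℝ} (hη : 0 < η) {t : ℝ} (ht : 0 ≤ t) :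
    (expMeasure η).real (Set.Iic t) = 1 - Real.exp (-(η * t)) := by
  have := isProbabilityMeasure_expMeasure hη
  rw [← cdf_eq_real, cdf_expMeasure_eq hη, if_pos ht]

lemma expMeasure_Iio_zero {η : ℝ} : expMeasure η (Set.Iio 0) = 0 := by
  rw [expMeasure, gammaMeasure, withDensity_apply _ measurableSet_Iio]
  exact lintegral_gammaPDF_of_nonpos le_rfl

lemma expMeasure_singleton (η : ℝ) (x : ℝ) : expMeasure η {x} = 0 := by
  rw [expMeasure, gammaMeasure]
  exact withDensity_absolutelyContinuous _ _ (by simp)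

/-- The Beta integral `∫ (1 - e^{-ηt})^j e^{-ηt(d+1)} dt = B(j + 1, d + 1) / η` over `t > 0`. -/
lemma integral_one_sub_exp_pow {η : ℝ} (hη : 0 < η) (j d : ℕ) :
    IntegrableOn (fun t : ℝ => (1 - Real.exp (-(η * t))) ^ j * Real.exp (-(η * t)) ^ (d + 1))
        (Set.Ioi 0) ∧
      ∫ t in Set.Ioi (0 : ℝ), (1 - Real.exp (-(η * t))) ^ j * Real.exp (-(η * t)) ^ (d + 1) =
        (j.factorial * d.factorial : ℝ) / ((j + d + 1).factorial * η) := by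
  induction j generalizing d with
  | zero =>
    have hpos : 0 < η * (d + 1) := by positivity
    have hfun : (fun t : ℝ => (1 - Real.exp (-(η * t))) ^ 0 * Real.exp (-(η * t)) ^ (d + 1)) =
        fun t => Real.exp (-(η * (d + 1)) * t) := by
      ext t
      rw [pow_zero, one_mul, ← Real.exp_nat_mul]
      congr 1
      push_cast
      ring
    rw [hfun]
    refine ⟨exp_neg_integrableOn_Ioi 0 hpos, ?_⟩
    rw [integral_exp_mul_Ioi (by linarith)]
    simp only [mul_zero, Real.exp_zero, Nat.factorial_zero, zero_add, Nat.factorial_succ]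
    push_cast
    have : (d.factorial : ℝ) ≠ 0 := by positivity
    field_simp
  | succ j ih =>
    have hfun : (fun t : ℝ => (1 - Real.exp (-(η * t))) ^ (j + 1) * Real.exp (-(η * t)) ^ (d + 1)) =
        fun t => (1 - Real.exp (-(η * t))) ^ j * Real.exp (-(η * t)) ^ (d + 1) -
          (1 - Real.exp (-(η * t))) ^ j * Real.exp (-(η * t)) ^ (d + 1 + 1) := by
      ext t; ring
    rw [hfun]
    refine ⟨(ih d).1.sub (ih (d + 1)).1, ?_⟩
    rw [integral_sub (ih d).1 (ih (d + 1)).1, (ih d).2, (ih (d + 1)).2,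
      show j + (d + 1) + 1 = (j + d + 1) + 1 by ring, show j + 1 + d + 1 = (j + d + 1) + 1 by ring,
      Nat.factorial_succ (j + d + 1), Nat.factorial_succ j, Nat.factorial_succ d]
    push_cast
    have : ((j + d + 1).factorial : ℝ) ≠ 0 := by positivity
    field_simp
    ring

/-- The expected time during which exactly `j` of `K` exponential clocks have rung. -/
lemma integral_choose_mul {η : ℝ} (hη : 0 < η) {j K : ℕ} (hj : j < K) :
    IntegrableOn (fun t : ℝ => (K.choose j : ℝ) *
        ((1 - Real.exp (-(η * t))) ^ j * Real.exp (-(η * t)) ^ (K - j))) (Set.Ioi 0) ∧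
      ∫ t in Set.Ioi (0 : ℝ), (K.choose j : ℝ) *
        ((1 - Real.exp (-(η * t))) ^ j * Real.exp (-(η * t)) ^ (K - j)) = 1 / (η * (K - j : ℕ)) := by
  obtain ⟨d, rfl⟩ : ∃ d, K = j + d + 1 := ⟨K - j - 1, by omega⟩
  rw [show j + d + 1 - j = d + 1 by omega]
  obtain ⟨h1, h2⟩ := integral_one_sub_exp_pow hη j d
  refine ⟨h1.const_mul _, ?_⟩
  rw [integral_const_mul, h2, Nat.cast_choose ℝ (by omega : j ≤ j + d + 1),
    show j + d + 1 - j = d + 1 by omega, Nat.factorial_succ d]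
  have : ((j + d + 1).factorial : ℝ) ≠ 0 := by positivity
  have : (j.factorial : ℝ) ≠ 0 := by positivity
  have : (d.factorial : ℝ) ≠ 0 := by positivity
  push_cast
  field_simp

lemma sum_one_div_sub_eq_harmonic {q K : ℕ} (hqK : q ≤ K) :
    ∑ j ∈ Finset.range q, (1 / ((K - j : ℕ) : ℝ)) = (harmonic K : ℝ) - (harmonic (K - q) : ℝ) := by
  induction q with
  | zero => simp
  | succ q ih =>
    rw [Finset.sum_range_succ, ih (by omega), show K - q = K - (q + 1) + 1 by omega, harmonic_succ]
    push_cast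
    ring

section Law

variable {Ω : Type*} [MeasurableSpace Ω] {Pr : Measure Ω}
  {K : ℕ} {lam : Fin K → Ω → ℝ} {η : ℝ}

lemma ae_nonneg_of_hasLaw_exp (hlam : ∀ k, HasLaw (lam k) (expMeasure η) Pr) :
    ∀ᵐ ω ∂Pr, ∀ k, 0 ≤ lam k ω := by
  refine ae_all_iff.2 fun k => ?_
  rw [(hlam k).ae_iff (p := fun x => 0 ≤ x) (measurableSet_setOfPred.1 measurableSet_Ici), ae_iff]
  simpa using! expMeasure_Iio_zero

lemma ae_injective_of_hasLaw_exp [IsProbabilityMeasure Pr] (hη : 0 < η)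
    (hlam : ∀ k, HasLaw (lam k) (expMeasure η) Pr)
    (hind : iIndepFun lam Pr) : ∀ᵐ ω ∂Pr, Function.Injective fun k => lam k ω := by
  have := isProbabilityMeasure_expMeasure hη
  have h1 : ∀ i j, i ≠ j → ∀ᵐ ω ∂Pr, lam i ω ≠ lam j ω := by
    intro i j hij
    have h2 := (indepFun_iff_map_prod_eq_prod_map_map (hlam i).aemeasurable
      (hlam j).aemeasurable).1 (hind.indepFun hij)
    rw [(hlam i).map_eq, (hlam j).map_eq] at h2
    have h3 : ((expMeasure η).prod (expMeasure η)) (Set.diagonal ℝ) = 0 := by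
      rw [Measure.measure_prod_null measurableSet_diagonal]
      refine ae_of_all _ fun x => ?_
      have : Prod.mk x ⁻¹' Set.diagonal ℝ = {x} := by ext y; simp [eq_comm]
      simpa only [this, Pi.zero_apply] using expMeasure_singleton η x
    rw [← h2, Measure.map_apply_of_aemeasurable
      ((hlam i).aemeasurable.prodMk (hlam j).aemeasurable) measurableSet_diagonal] at h3
    rw [ae_iff]
    simpa using! h3
  have h4 : ∀ᵐ ω ∂Pr, ∀ i j, i ≠ j → lam i ω ≠ lam j ω :=
    ae_all_iff.2 fun i => ae_all_iff.2 fun j => by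
      by_cases hij : i = j
      · simp [hij]
      · simpa [hij] using h1 i j hij
  filter_upwards [h4] with ω h i j hij
  by_contra hne
  exact h i j hne hij

/-- The number of exponential clocks that have rung by time `t` is binomial: the vectors `l` for
which exactly the clocks in `A` have rung form a box, whose measure is a product. -/
lemma measure_lt_orderStat (hη : 0 < η) (hlam : ∀ k, HasLaw (lam k) (expMeasure η) Pr)
    (hind : iIndepFun lam Pr) {q : ℕ} (hq : 0 < q) (hqK : q ≤ K) {t : ℝ} (ht : 0 ≤ t) :
    Pr {ω | t < orderStat q hq hqK fun k => lam k ω} =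
      ENNReal.ofReal (∑ j ∈ Finset.range q, (K.choose j : ℝ) *
        ((1 - Real.exp (-(η * t))) ^ j * Real.exp (-(η * t)) ^ (K - j))) := by
  have := isProbabilityMeasure_expMeasure hη
  have hlaw := hind.hasLaw_pi hlam
  have hmeas : MeasurableSet {l : Fin K → ℝ | t < orderStat q hq hqK l} :=
    measurableSet_lt measurable_const (measurable_orderStat hq hqK)
  have h1 := hlaw.measure_eq (p := fun l => t < orderStat q hq hqK l) hmeas
  rw [h1, ← ofReal_measureReal]
  congr 1
  let box : Finset (Fin K) → Set (Fin K → ℝ) := fun A =>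
    Set.univ.pi fun k => if k ∈ A then Set.Iic t else Set.Ioi t
  have hbox : ∀ A l, l ∈ box A ↔ A = Finset.univ.filter fun k => l k ≤ t := by
    intro A l
    simp only [box, Set.mem_univ_pi, Finset.ext_iff, Finset.mem_filter, Finset.mem_univ, true_and]
    refine forall_congr' fun k => ?_
    by_cases hk : k ∈ A <;> simp [hk]
  have hset : {l : Fin K → ℝ | t < orderStat q hq hqK l} =
      ⋃ A ∈ (Finset.range q).biUnion fun j => Finset.powersetCard j Finset.univ, box A := by
    ext l
    simp only [Set.mem_ofPred_eq, Set.mem_iUnion, hbox, Finset.mem_biUnion, Finset.mem_range,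
      Finset.mem_powersetCard, Finset.subset_univ, true_and, exists_eq_right', exists_prop,
      exists_eq_right]
    rw [← not_le, orderStat_le_iff, not_le]
  have hbm : ∀ A, MeasurableSet (box A) := fun A => MeasurableSet.univ_pi fun k => by
    split_ifs
    · exact measurableSet_Iic
    · exact measurableSet_Ioi
  have hpr : ∀ A, (Measure.pi fun _ : Fin K => expMeasure η).real (box A) =
      (1 - Real.exp (-(η * t))) ^ A.card * Real.exp (-(η * t)) ^ (K - A.card) := by
    intro A
    rw [measureReal_def, Measure.pi_pi, ENNReal.toReal_prod]
    simp only [← measureReal_def]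
    have : ∀ k, (expMeasure η).real (if k ∈ A then Set.Iic t else Set.Ioi t) =
        if k ∈ A then 1 - Real.exp (-(η * t)) else Real.exp (-(η * t)) := by
      intro k
      split_ifs
      · exact expMeasure_Iic hη ht
      · exact expMeasure_Ioi hη ht
    simp only [this, Finset.prod_ite, Finset.prod_const]
    congr 2
    · congr 1; ext; simp
    · rw [Finset.filter_not, ← Finset.compl_eq_univ_sdiff, Finset.card_compl, Fintype.card_fin]
      congr 2; ext; simp
  rw [hset, measureReal_biUnion_finset ?_ fun A _ => hbm A, Finset.sum_biUnion ?_]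
  · refine Finset.sum_congr rfl fun j _ => ?_
    rw [Finset.sum_congr rfl fun A hA => by rw [hpr A, (Finset.mem_powersetCard.1 hA).2],
      Finset.sum_const, Finset.card_powersetCard, Finset.card_univ, Fintype.card_fin, nsmul_eq_mul]
  · intro i _ j _ hij
    exact Finset.pairwise_disjoint_powersetCard _ hij
  · intro A _ B _ hAB
    rw [Function.onFun, Set.disjoint_left]
    intro l hl hl'
    exact hAB (((hbox A l).1 hl).trans ((hbox B l).1 hl').symm)

/-- The mean of the `q`-th smallest of `K` independent exponential variables, from the layer-cake
formula. -/
lemma integral_orderStat (hη : 0 < η) (hlam : ∀ k, HasLaw (lam k) (expMeasure η) Pr)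
    (hind : iIndepFun lam Pr) {q : ℕ} (hq : 0 < q) (hqK : q ≤ K) :
    Integrable (fun ω => orderStat q hq hqK fun k => lam k ω) Pr ∧
      ∫ ω, orderStat q hq hqK (fun k => lam k ω) ∂Pr =
        ((harmonic K : ℝ) - (harmonic (K - q) : ℝ)) / η := by
  have hm : AEMeasurable (fun ω => orderStat q hq hqK fun k => lam k ω) Pr :=
    (measurable_orderStat hq hqK).comp_aemeasurable
      (aemeasurable_pi_lambda _ fun k => (hlam k).aemeasurable)
  have hnn : 0 ≤ᵐ[Pr] fun ω => orderStat q hq hqK fun k => lam k ω := by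
    filter_upwards [ae_nonneg_of_hasLaw_exp hlam] with ω h using orderStat_nonneg hq hqK h
  let g : ℕ → ℝ → ℝ := fun j t => (K.choose j : ℝ) *
    ((1 - Real.exp (-(η * t))) ^ j * Real.exp (-(η * t)) ^ (K - j))
  have hg : ∀ j ∈ Finset.range q, IntegrableOn (g j) (Set.Ioi 0) := fun j hj =>
    (integral_choose_mul hη ((Finset.mem_range.1 hj).trans_le hqK)).1
  have hgnn : ∀ j, ∀ t ∈ Set.Ioi (0 : ℝ), 0 ≤ g j t := by
    intro j t ht
    have : Real.exp (-(η * t)) ≤ 1 :=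
      Real.exp_le_one_iff.2 (neg_nonpos.2 (mul_pos hη ht).le)
    exact mul_nonneg (Nat.cast_nonneg _)
      (mul_nonneg (pow_nonneg (sub_nonneg.2 this) _) (pow_nonneg (Real.exp_pos _).le _))
  have hlint : ∫⁻ ω, ENNReal.ofReal (orderStat q hq hqK fun k => lam k ω) ∂Pr =
      ENNReal.ofReal (((harmonic K : ℝ) - (harmonic (K - q) : ℝ)) / η) := by
    rw [lintegral_eq_lintegral_meas_lt Pr hnn hm, setLIntegral_congr_fun measurableSet_Ioi
      fun t ht => measure_lt_orderStat hη hlam hind hq hqK (le_of_lt ht),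
      ← ofReal_integral_eq_lintegral_ofReal (integrable_finsetSum _ hg)]
    · rw [integral_finsetSum _ hg, ← sum_one_div_sub_eq_harmonic hqK, Finset.sum_div]
      congr 1
      refine Finset.sum_congr rfl fun j hj => ?_
      rw [(integral_choose_mul hη ((Finset.mem_range.1 hj).trans_le hqK)).2, div_div, mul_comm]
    · filter_upwards [ae_restrict_mem measurableSet_Ioi] with t ht
      exact Finset.sum_nonneg fun j _ => hgnn j t ht
  refine ⟨(lintegral_ofReal_ne_top_iff_integrable hm.aestronglyMeasurable hnn).1
    (by rw [hlint]; exact ENNReal.ofReal_ne_top), ?_⟩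
  rw [integral_eq_lintegral_of_nonneg_ae hnn hm.aestronglyMeasurable, hlint, ENNReal.toReal_ofReal]
  rw [← sum_one_div_sub_eq_harmonic hqK]
  positivity

end Law

/-! ### Generic invertibility of the channel -/

lemma groupChannel_add_smul {N K : ℕ} (h g : Fin N → Fin K → ℂ) (T : Finset (Fin K)) (j : Fin N)
    (x : ℂ) : groupChannel (h + x • g) T j = groupChannel h T j + x • groupChannel g T j := by
  ext a e
  simp [groupChannel]

/-- The users of a group, and its transmitters, are distinct, so each square matrix is the channel
of the group for some overall channel; it is enough to realise the identity matrix. -/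
lemma exists_groupChannel_eq_one {N K : ℕ} (T : Finset (Fin K)) (j : Fin N) :
    ∃ g : Fin N → Fin K → ℂ, groupChannel g T j = 1 := by
  classical
  let u : Fin (min T.card N) → Fin N := fun a =>
    ⟨((j : ℕ) + (a : ℕ)) % N, Nat.mod_lt _ (Nat.zero_lt_of_lt j.isLt)⟩
  let c : Fin (min T.card N) → Fin K := fun e =>
    T.orderEmbOfFin rfl (Fin.castLE (min_le_left _ _) e)
  have hu : Function.Injective u := by
    intro a b hab
    have h1 : ((j : ℕ) + a) ≡ ((j : ℕ) + b) [MOD N] := Fin.mk.inj hab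
    have ha : (a : ℕ) < N := a.isLt.trans_le (min_le_right _ _)
    have hb : (b : ℕ) < N := b.isLt.trans_le (min_le_right _ _)
    exact Fin.ext (Nat.ModEq.eq_of_lt_of_lt (Nat.ModEq.add_left_cancel' _ h1) ha hb)
  have hc : Function.Injective c :=
    (T.orderEmbOfFin rfl).injective.comp (Fin.castLE_injective _)
  refine ⟨fun n k => if ∃ a, u a = n ∧ c a = k then 1 else 0, ?_⟩
  ext a e
  change (if ∃ b, u b = u a ∧ c b = c e then (1 : ℂ) else 0) = _
  rw [Matrix.one_apply]
  congr 1
  simp only [hu.eq_iff, hc.eq_iff, eq_iff_iff]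
  exact ⟨fun ⟨b, h1, h2⟩ => h1.symm.trans h2, fun h => ⟨a, rfl, h⟩⟩

lemma measurable_det_groupChannel {N K : ℕ} (T : Finset (Fin K)) (j : Fin N) :
    Measurable fun h : Fin N → Fin K → ℂ => (groupChannel h T j).det := by
  have : Continuous fun h : Fin N → Fin K → ℂ => (groupChannel h T j).det := by
    refine Continuous.matrix_det (continuous_matrix fun a e => ?_)
    simp only [groupChannel, Matrix.of_apply]
    fun_prop
  exact this.measurable

/-- Along a line whose direction gives the group the identity matrix, the determinant is a
characteristic polynomial, which has finitely many roots. -/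
lemma ae_volume_det_groupChannel_ne_zero {N K : ℕ} (T : Finset (Fin K)) (j : Fin N) :
    ∀ᵐ h : Fin N → Fin K → ℂ, (groupChannel h T j).det ≠ 0 := by
  obtain ⟨g, hg⟩ := exists_groupChannel_eq_one T j
  -- given explicitly, as `volume` on the iterated function space is a product of products
  have : (volume : Measure (Fin K → ℂ)).IsAddHaarMeasure := inferInstance
  have : (volume : Measure (Fin N → Fin K → ℂ)).IsAddHaarMeasure := Measure.pi.isAddHaarMeasure _
  refine ae_mem_of_ae_add_linearMap_mem (𝕜 := ℂ) (LinearMap.toSpanSingleton ℂ _ g)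
    (volume : Measure ℂ) volume (s := {h | (groupChannel h T j).det ≠ 0})
    ((measurable_det_groupChannel T j) (measurableSet_singleton 0).compl) fun y => ?_
  have hfin : {x : ℂ | (groupChannel (y + x • g) T j).det = 0}.Finite := by
    refine ((-groupChannel y T j).charpoly.rootSet_finite ℂ).subset fun x hx => ?_
    rw [Polynomial.mem_rootSet]
    refine ⟨(Matrix.charpoly_monic _).ne_zero, ?_⟩
    rw [Polynomial.coe_aeval_eq_eval, Matrix.eval_charpoly, ← hx, groupChannel_add_smul, hg,
      sub_neg_eq_add, add_comm, Matrix.smul_one_eq_diagonal]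
    rfl
  rw [ae_iff]
  simpa using! hfin.measure_zero volume

lemma ae_det_groupChannel_ne_zero {Ω : Type*} [MeasurableSpace Ω] {Pr : Measure Ω} {N K : ℕ}
    {h : ℕ → Fin N → Ω → Fin N → Fin K → ℂ} (hmeas : ∀ i j, AEMeasurable (h i j) Pr)
    (hcont : ∀ i j, (Pr.map (h i j)) ≪ (volume : Measure (Fin N → Fin K → ℂ))) :
    ∀ᵐ ω ∂Pr, ∀ i j T, (groupChannel (h i j ω) T j).det ≠ 0 :=
  ae_all_iff.2 fun i => ae_all_iff.2 fun j => ae_all_iff.2 fun T =>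
    ae_of_ae_map (hmeas i j) ((hcont i j).ae_le (ae_volume_det_groupChannel_ne_zero T j))

/-! ### Downlink time at high power -/

/-- Zero-forcing removes the interference: each user sees the same power, proportional to `P`. -/
lemma exists_sessionTime_eq {u : ℕ} (hu : 0 < u) {A : Matrix (Fin u) (Fin u) ℂ} (hA : A.det ≠ 0)
    (bits : ℝ) :
    ∃ c > 0, ∀ P ≥ 0, sessionTime A bits P = bits / Real.logb 2 (1 + c * P) := by
  have : Nonempty (Fin u) := ⟨⟨0, hu⟩⟩
  have hunit : IsUnit A.det := isUnit_iff_ne_zero.2 hA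
  set M : ℝ := ⨆ k, ∑ a, ‖A⁻¹ k a‖ ^ 2 with hM
  have hMpos : 0 < M := by
    have hne : A⁻¹ ≠ 0 := by
      intro h0
      have := Matrix.mul_nonsing_inv A hunit
      rw [h0, mul_zero] at this
      exact zero_ne_one this
    obtain ⟨k, a, hka⟩ : ∃ k a, A⁻¹ k a ≠ 0 := by
      by_contra! h
      exact hne (by ext k a; exact h k a)
    calc 0 < ‖A⁻¹ k a‖ ^ 2 := by positivity
      _ ≤ ∑ a, ‖A⁻¹ k a‖ ^ 2 :=
        Finset.single_le_sum (f := fun a => ‖A⁻¹ k a‖ ^ 2) (fun _ _ => by positivity)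
          (Finset.mem_univ a)
      _ ≤ M := le_ciSup (f := fun k => ∑ a, ‖A⁻¹ k a‖ ^ 2) (Set.finite_range _).bddAbove k
  refine ⟨M⁻¹, inv_pos.2 hMpos, fun P hP => ?_⟩
  have hAV : A * zfPrecoder A P = ((Real.sqrt (P / M) : ℝ) : ℂ) • 1 := by
    rw [zfPrecoder, Matrix.mul_smul, Matrix.mul_nonsing_inv A hunit]
  have hsinr : ∀ a, sinr A (zfPrecoder A P) a = M⁻¹ * P := by
    intro a
    rw [sinr, hAV, Finset.sum_eq_zero]
    · simp only [Matrix.smul_apply, Matrix.one_apply_eq, smul_eq_mul, mul_one, Complex.norm_real,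
        Real.norm_eq_abs, sq_abs, Real.sq_sqrt (div_nonneg hP hMpos.le)]
      ring
    · intro a' ha'
      simp [Matrix.one_apply_ne (Finset.ne_of_mem_erase ha').symm]
  simp only [sessionTime, hsinr, ciSup_const]

lemma tendsto_logb_div_logb {c : ℝ} (hc : 0 < c) :
    Tendsto (fun P : ℝ => Real.logb 2 P / Real.logb 2 (1 + c * P)) atTop (𝓝 1) := by
  have h1 : Tendsto (fun P : ℝ => Real.log (P⁻¹ + c) / Real.log P + 1) atTop (𝓝 1) := by
    have h2 : Tendsto (fun P : ℝ => Real.log (P⁻¹ + c)) atTop (𝓝 (Real.log c)) := by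
      have : Tendsto (fun P : ℝ => P⁻¹ + c) atTop (𝓝 (0 + c)) :=
        tendsto_inv_atTop_zero.add tendsto_const_nhds
      rw [zero_add] at this
      exact this.log hc.ne'
    simpa using (h2.div_atTop Real.tendsto_log_atTop).add_const 1
  have h3 := h1.inv₀ one_ne_zero
  rw [inv_one] at h3
  refine h3.congr' ?_
  filter_upwards [eventually_gt_atTop 1] with P hP
  have hP0 : 0 < P := by linarith
  have hlog : Real.log P ≠ 0 := (Real.log_pos hP).ne'
  have hsplit : Real.log (1 + c * P) = Real.log (P⁻¹ + c) + Real.log P := by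
    rw [← Real.log_mul (by positivity) hP0.ne']
    congr 1
    field_simp
  rw [Real.logb, Real.logb, div_div_div_cancel_right₀ (Real.log_pos one_lt_two).ne', hsplit,
    div_add_one hlog, inv_div]

/-- Joint transmission from `T` takes `1 / T.card` of the reference time `N L / log P`: each of the
`N` groups needs asymptotically `(L / T.card) / log P`. -/
lemma tendsto_deliveryTime {N K L : ℕ} (hN : 0 < N) (hL : 0 < L) {h : Fin N → Fin N → Fin K → ℂ}
    {T : Finset (Fin K)} (hT : 0 < T.card) (hTN : T.card ≤ N)
    (hdet : ∀ j, (groupChannel (h j) T j).det ≠ 0) :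
    Tendsto (fun P => deliveryTime L h T P / ((N : ℝ) * (L : ℝ) / Real.logb 2 P)) atTop
      (𝓝 (1 / (T.card : ℝ))) := by
  have hu : 0 < min T.card N := lt_min hT hN
  choose c hc hs using fun j =>
    exists_sessionTime_eq hu (hdet j) ((L : ℝ) / ((min T.card N : ℕ) : ℝ))
  have hlim : Tendsto (fun P => ∑ j, (1 / ((N : ℝ) * T.card)) *
      (Real.logb 2 P / Real.logb 2 (1 + c j * P))) atTop
      (𝓝 (∑ _j : Fin N, (1 / ((N : ℝ) * T.card)) * 1)) :=
    tendsto_finsetSum _ fun j _ => (tendsto_logb_div_logb (hc j)).const_mul _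
  have hN' : (N : ℝ) ≠ 0 := by positivity
  have hL' : (L : ℝ) ≠ 0 := by positivity
  have hT' : (T.card : ℝ) ≠ 0 := by positivity
  have hval : ∑ _j : Fin N, (1 / ((N : ℝ) * T.card)) * 1 = 1 / (T.card : ℝ) := by
    rw [Finset.sum_const, Finset.card_univ, Fintype.card_fin, nsmul_eq_mul]
    field_simp
  rw [hval] at hlim
  refine hlim.congr' ?_
  filter_upwards [eventually_gt_atTop 0] with P hP
  rw [deliveryTime, Finset.sum_div]
  refine Finset.sum_congr rfl fun j _ => ?_
  have hlog : Real.logb 2 (1 + c j * P) ≠ 0 :=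
    (Real.logb_pos one_lt_two (by have := mul_pos (hc j) hP; linarith)).ne'
  rw [hs j P hP.le, min_eq_left hTN, div_div_eq_mul_div]
  field_simp

lemma HybridScheme.tendsto_normDown {F : Type*} [Field F] [DecidableEq F] {K m cap q : ℕ}
    {ρ₁ : ℝ} {ρ₂ : ℕ} (S : HybridScheme F K m cap q ρ₁ ρ₂) {N L : ℕ} (hN : 0 < N) (hL : 0 < L)
    (hρN : ρ₂ ≤ N) {τ : ℝ} {l : Fin K → ℝ} (hT : (finished K cap q τ l).card = q)
    {h : ℕ → Fin N → Fin N → Fin K → ℂ} (hdet : ∀ i j T, (groupChannel (h i j) T j).det ≠ 0) :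
    Tendsto (S.normDown L τ l h) atTop (𝓝 (zfLatency K m q ρ₁ ρ₂)) := by
  rw [← S.sum_inv_redundancy hT]
  refine (tendsto_finsetSum _ fun (i : Fin S.n) hi => tendsto_deliveryTime hN hL (h := h i)
    (Finset.card_pos.2 (S.send_computed _ hT.ge i hi)) ?_ fun j => hdet i j _).congr fun P => ?_
  · exact (Finset.card_le_card Finset.inter_subset_left).trans ((S.place_card i).le.trans hρN)
  · rw [normDown, downTime, Finset.sum_div]

/-! ### The latency of a scheme, and the optimal scheme -/

namespace HybridScheme

variable {F : Type*} [Field F] [DecidableEq F] {K m cap q : ℕ} {ρ₁ : ℝ} {ρ₂ : ℕ}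
  (S : HybridScheme F K m cap q ρ₁ ρ₂)
  {Ω : Type*} [MeasurableSpace Ω] {Pr : Measure Ω} [IsProbabilityMeasure Pr]
  {lam : Fin K → Ω → ℝ} {η τ : ℝ}

lemma integral_deltaC (hη : 0 < η) (hlam : ∀ k, HasLaw (lam k) (expMeasure η) Pr)
    (hind : iIndepFun lam Pr) (hq : 0 < q) (hqK : q ≤ K) (hcap : 0 < cap) (hτ : 0 < τ) :
    Integrable (fun ω => S.deltaC τ (fun k => lam k ω)) Pr ∧
      ∫ ω, S.deltaC τ (fun k => lam k ω) ∂Pr =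
        ((harmonic K : ℝ) - (harmonic (K - q) : ℝ)) / (η * τ) + cap := by
  obtain ⟨hint, hval⟩ := integral_orderStat hη hlam hind hq hqK
  have hae : (fun ω => S.deltaC τ (fun k => lam k ω)) =ᵐ[Pr]
      fun ω => orderStat q hq hqK (fun k => lam k ω) / τ + cap := by
    filter_upwards [ae_nonneg_of_hasLaw_exp hlam] with ω hω
    rw [deltaC, compTime_eq hq hqK hcap hτ hω]
    field_simp
  refine ⟨((hint.div_const τ).add (integrable_const _)).congr hae.symm, ?_⟩
  rw [integral_congr_ae hae, integral_add (hint.div_const τ) (integrable_const _),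
    integral_div, hval, div_div, integral_const]
  simp

lemma ae_tendsto_normDown (hη : 0 < η) (hlam : ∀ k, HasLaw (lam k) (expMeasure η) Pr)
    (hind : iIndepFun lam Pr) (hq : 0 < q) (hqK : q ≤ K) (hcap : 0 < cap) (hτ : 0 < τ)
    {N L : ℕ} (hN : 0 < N) (hL : 0 < L) (hρN : ρ₂ ≤ N)
    {h : ℕ → Fin N → Ω → Fin N → Fin K → ℂ} (hmeas : ∀ i j, AEMeasurable (h i j) Pr)
    (hcont : ∀ i j, (Pr.map (h i j)) ≪ (volume : Measure (Fin N → Fin K → ℂ))) :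
    ∀ᵐ ω ∂Pr, Tendsto (S.normDown L τ (fun k => lam k ω) (fun i j => h i j ω)) atTop
      (𝓝 (zfLatency K m q ρ₁ ρ₂)) := by
  filter_upwards [ae_nonneg_of_hasLaw_exp hlam, ae_injective_of_hasLaw_exp hη hlam hind,
    ae_det_groupChannel_ne_zero hmeas hcont] with ω h1 h2 h3
  exact S.tendsto_normDown hN hL hρN (card_finished hq hqK hcap hτ h1 h2) h3

end HybridScheme

lemma Admissible.finite_setOf_params {K m : ℕ} {μ : ℝ} (q : ℕ) :
    {p : ℝ × ℕ | Admissible K m μ q p.1 p.2}.Finite := by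
  refine (((Set.finite_Iic K).image fun j : ℕ => (j : ℝ) / (q : ℝ)).prod
    (Set.finite_Iic ⌊(K : ℝ) * μ⌋₊)).subset ?_
  rintro ⟨ρ₁, ρ₂⟩ hA
  obtain ⟨j, -, hj, hρ⟩ := hA.2.1
  exact ⟨⟨j, hj, hρ.symm⟩, hA.ρ₂_le_floor⟩

lemma Set.Finite.isLeast_csInf {s : Set ℝ} (hs : s.Finite) (hne : s.Nonempty) :
    IsLeast s (sInf s) :=
  ⟨hne.csInf_mem hs, fun _ hx => csInf_le hs.bddBelow hx⟩

theorem proposition3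
    {F : Type*} [Field F] [Fintype F] [DecidableEq F] (L : ℕ) (hF : Fintype.card F = 2 ^ L)
    (K N m cap : ℕ) (hm : 0 < m) (μ η τ γ : ℝ)
    (hK : 0 < K) (hμK : 1 / (K : ℝ) ≤ μ) (hμ1 : μ ≤ 1) (hcap : (cap : ℝ) = (m : ℝ) * μ)
    (hη : 0 < η) (hτ : 0 < τ) (hγ : 0 ≤ γ)
    -- there are enough users for zero-forcing at the largest possible redundancy
    (hN : ⌊(K : ℝ) * μ⌋₊ ≤ N)
    -- set-up times and channels
    {Ω : Type*} [MeasurableSpace Ω] (Pr : Measure Ω) [IsProbabilityMeasure Pr]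
    (lam : Fin K → Ω → ℝ) (hlam : ∀ k, HasLaw (lam k) (expMeasure η) Pr)
    (hind : iIndepFun lam Pr)
    (h : ℕ → Fin N → Ω → Fin N → Fin K → ℂ) (hmeas : ∀ i j, AEMeasurable (h i j) Pr)
    (hcont : ∀ i j, (Pr.map (h i j)) ≪ (volume : Measure (Fin N → Fin K → ℂ)))
    -- the design is possible, and the codes that it uses exist over the field
    (hne : ∃ q ρ₁ ρ₂, Admissible K m μ q ρ₁ ρ₂)
    (hMDS : ∀ q ρ₁ ρ₂, Admissible K m μ q ρ₁ ρ₂ → ∀ n : ℕ, (n : ℝ) = ρ₁ * (m : ℝ) →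
      ∃ G : Matrix (Fin n) (Fin m) F, IsMDS G) :
    -- each scheme works, and has the stated latency
    (∀ q ρ₁ ρ₂, Admissible K m μ q ρ₁ ρ₂ → ∀ S : HybridScheme F K m cap q ρ₁ ρ₂,
      (∀ (r : ℕ) (W : Matrix (Fin m) (Fin r) F),
        (∀ v ∈ stoppingSet K cap q, S.Feasible N W v) ∧
        (∀ T : Finset (Fin K), q ≤ T.card → ∀ X X' : Matrix (Fin r) (Fin N) F,
          (∀ i ∈ S.send T, S.iv W X i = S.iv W X' i) → W * X = W * X')) ∧
      Integrable (fun ω => S.deltaC τ (fun k => lam k ω)) Pr ∧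
      Integrable (fun ω => S.deltaD L τ (fun k => lam k ω) (fun i j => h i j ω)) Pr ∧
      (∀ᵐ ω ∂Pr, Tendsto (S.normDown L τ (fun k => lam k ω) (fun i j => h i j ω)) atTop
        (𝓝 (S.deltaD L τ (fun k => lam k ω) (fun i j => h i j ω)))) ∧
      S.avgLatency L τ γ Pr lam h =
        ((harmonic K : ℝ) - (harmonic (K - q) : ℝ)) / (η * τ) + (m : ℝ) * μ +
          γ * zfLatency K m q ρ₁ ρ₂) ∧
    -- the optimal latency
    IsLeast {δ : ℝ | ∃ q ρ₁ ρ₂, Admissible K m μ q ρ₁ ρ₂ ∧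
        ∃ S : HybridScheme F K m cap q ρ₁ ρ₂, δ = S.avgLatency L τ γ Pr lam h}
      (sInf ((fun q : ℕ =>
          ((harmonic K : ℝ) - (harmonic (K - q) : ℝ)) / (η * τ) + (m : ℝ) * μ +
            γ * sInf ((fun p : ℝ × ℕ => zfLatency K m q p.1 p.2) ''
              {p | Admissible K m μ q p.1 p.2})) ''
        {q | ∃ ρ₁ ρ₂, Admissible K m μ q ρ₁ ρ₂})) := by
  have hK' : (0 : ℝ) < K := by exact_mod_cast hK
  have hμ : 0 < μ := (one_div_pos.2 hK').trans_le hμK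
  have hm' : (0 : ℝ) < m := by exact_mod_cast hm
  have hcap0 : 0 < cap := by
    rw [← Nat.cast_pos (α := ℝ), hcap]; positivity
  -- a field has at least two elements
  have hL : 0 < L := by
    rcases Nat.eq_zero_or_pos L with rfl | hL
    · have := Fintype.one_lt_card (α := F)
      omega
    · exact hL
  -- as `1 ≤ ⌊K μ⌋₊ ≤ N`
  have hN0 : 0 < N := by
    have : (1 : ℝ) ≤ K * μ := by
      rw [div_le_iff₀ hK'] at hμK
      linarith
    exact (Nat.le_floor (by exact_mod_cast this)).trans hN
  have hscheme : ∀ q ρ₁ ρ₂, Admissible K m μ q ρ₁ ρ₂ → ∀ S : HybridScheme F K m cap q ρ₁ ρ₂,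
      (∀ (r : ℕ) (W : Matrix (Fin m) (Fin r) F),
        (∀ v ∈ stoppingSet K cap q, S.Feasible N W v) ∧
        (∀ T : Finset (Fin K), q ≤ T.card → ∀ X X' : Matrix (Fin r) (Fin N) F,
          (∀ i ∈ S.send T, S.iv W X i = S.iv W X' i) → W * X = W * X')) ∧
      Integrable (fun ω => S.deltaC τ (fun k => lam k ω)) Pr ∧
      Integrable (fun ω => S.deltaD L τ (fun k => lam k ω) (fun i j => h i j ω)) Pr ∧
      (∀ᵐ ω ∂Pr, Tendsto (S.normDown L τ (fun k => lam k ω) (fun i j => h i j ω)) atTop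
        (𝓝 (S.deltaD L τ (fun k => lam k ω) (fun i j => h i j ω)))) ∧
      S.avgLatency L τ γ Pr lam h =
        ((harmonic K : ℝ) - (harmonic (K - q) : ℝ)) / (η * τ) + (m : ℝ) * μ +
          γ * zfLatency K m q ρ₁ ρ₂ := by
    intro q ρ₁ ρ₂ hA S
    have hC := S.integral_deltaC hη hlam hind (hA.q_pos hμ) hA.q_le hcap0 hτ
    have hlim := S.ae_tendsto_normDown hη hlam hind (hA.q_pos hμ) hA.q_le hcap0 hτ hN0 hL
      (hA.ρ₂_le_floor.trans hN) hmeas hcont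
    have hD : (fun ω => S.deltaD L τ (fun k => lam k ω) (fun i j => h i j ω)) =ᵐ[Pr]
        fun _ => zfLatency K m q ρ₁ ρ₂ := by
      filter_upwards [hlim] with ω hω using hω.limUnder_eq
    refine ⟨fun r W => ⟨fun v hv => S.feasible_of_mem_stoppingSet hA hμ hμ1 N W hv,
      fun T hT X X' hX => S.mul_eq_of_iv_eq (S.send_card T hT).ge hX⟩, hC.1,
      (integrable_const _).congr hD.symm, ?_, ?_⟩
    · filter_upwards [hlim, hD] with ω h1 h2
      rwa [h2]
    · rw [HybridScheme.avgLatency, hC.2, integral_congr_ae hD, integral_const, hcap]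
      simp
  refine ⟨hscheme, ?_⟩
  have hinner := fun q (hq : ∃ ρ₁ ρ₂, Admissible K m μ q ρ₁ ρ₂) =>
    ((Admissible.finite_setOf_params (K := K) (m := m) (μ := μ) q).image
      fun p : ℝ × ℕ => zfLatency K m q p.1 p.2).isLeast_csInf
      (Set.Nonempty.image _ (let ⟨ρ₁, ρ₂, hA⟩ := hq; ⟨(ρ₁, ρ₂), hA⟩))
  have houter := (Set.Finite.image (fun q : ℕ =>
      ((harmonic K : ℝ) - (harmonic (K - q) : ℝ)) / (η * τ) + (m : ℝ) * μ +
        γ * sInf ((fun p : ℝ × ℕ => zfLatency K m q p.1 p.2) ''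
          {p | Admissible K m μ q p.1 p.2})) ((Set.finite_Iic K).subset
      (fun q ⟨_, _, hA⟩ => hA.q_le : {q | ∃ ρ₁ ρ₂, Admissible K m μ q ρ₁ ρ₂} ⊆ Set.Iic K)
      )).isLeast_csInf (Set.Nonempty.image _ hne)
  constructor
  · obtain ⟨q, hq, hqval⟩ := houter.1
    obtain ⟨⟨ρ₁, ρ₂⟩, hA, hval⟩ := (hinner q hq).1
    obtain ⟨S⟩ := Admissible.exists_hybridScheme (F := F) hA hm hμ hμ1 hcap (hMDS q ρ₁ ρ₂ hA)
    refine ⟨q, ρ₁, ρ₂, hA, S, ?_⟩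
    rw [(hscheme q ρ₁ ρ₂ hA S).2.2.2.2, ← hqval]
    simp only
    rw [← hval]
  · rintro δ ⟨q, ρ₁, ρ₂, hA, S, rfl⟩
    rw [(hscheme q ρ₁ ρ₂ hA S).2.2.2.2]
    refine (houter.2 ⟨q, ⟨ρ₁, ρ₂, hA⟩, rfl⟩).trans ?_
    have := (hinner q ⟨ρ₁, ρ₂, hA⟩).2 ⟨(ρ₁, ρ₂), hA, rfl⟩
    exact add_le_add_right (mul_le_mul_of_nonneg_left this hγ) _
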